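/- Work in ZFC. Let $\kappa$ be an ordinal. For sets $A,B$, regard $(A,B)$ as a two-sorted structure: first-sort variables range over $A$, second-sort variables range over $B$, and formulas are the first-order formulas of the two-sorted language whose atomic formulas are $x\in y$ and $x=y$, for variables $x,y$ of arbitrary sorts, interpreted by true membership and equality. For a set $X$, let $\pi_X$ be the collapsing map $\pi_X(x)=\{\pi_X(y): y\in x\cap X\}$ (not required to be injective) and call $\{\pi_X(x):x\in X\}$ the transitive collapse of $X$. Say that $V_\kappa$ satisfies *reflection* if for every ordinal $\lambda>\kappa$, every two-sorted formula $\varphi$, and all finite tuples of parameters $\vec a$ from $V_\kappa$ (first sort) and $\vec b$ from $V_\lambda$ (second sort) with $(V_\kappa,V_\lambda)\models\varphi[\vec a,\vec b]$, there are an ordinal $\alpha<\kappa$ and a set $X\subseteq V_\lambda$ such that 1. every entry of $\vec a$ belongs to $V_\alpha$ and every entry of $\vec b$ belongs to $X$; 2. $|X|<\beth_\kappa$; 3. the transitive collapse of $X$ is $V_\beta$ for some ordinal $\beta>\alpha$; 4. $(V_\alpha,X)\models\varphi[\vec a,\vec b]$. Then $V_\kappa$ satisfies reflection if and only if $\kappa$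 is a supercompact cardinal, that is, $\kappa$ is an uncountable cardinal and for every set $A$ with $|A|\ge\kappa$ there is a normal measure on $P_\kappa(A)=\{s\subseteq A:|s|<\kappa\}$: a $\kappa$-complete ultrafilter $U$ on $P_\kappa(A)$ such that $\{s: x\in s\}\in U$ for every $x\in A$, and every $f:P_\kappa(A)\to A$ with $\{s:f(s)\in s\}\in U$ is constant on a set in $U$. -/

import Mathlib

universe u

open scoped ZFSet Cardinal

namespace LevelReflection

/-! ### The two-sorted language of set theory -/

/-- Formulas of the two-sorted first-order language of set theory, with free variables among
`m` variables of the first sort and `n` variables of the second sort. The atomic formulas are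
membership and equality between variables of arbitrary sorts; the sort of a variable is the side
of the sum `Fin m ⊕ Fin n` on which it lies. The other connectives and the existential
quantifiers are defined from these in the usual (classical) way. -/
inductive Formula : ℕ → ℕ → Type
  | falsum {m n : ℕ} : Formula m n
  | mem {m n : ℕ} (s t : Fin m ⊕ Fin n) : Formula m n
  | eq {m n : ℕ} (s t : Fin m ⊕ Fin n) : Formula m n
  | imp {m n : ℕ} (φ ψ : Formula m n) : Formula m n
  | allFst {m n : ℕ} (φ : Formula (m + 1) n) : Formula m n
  | allSnd {m n : ℕ} (φ : Formula m (n + 1)) : Formula m n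

/-- Tarskian satisfaction `(A, B) ⊨ φ[a, b]`: variables of the first sort range over the elements
of `A`, those of the second sort over the elements of `B`, and membership and equality are the
true ones. A quantifier binds the last variable of its sort. -/
def Formula.Sat (A B : ZFSet.{u}) : {m n : ℕ} → Formula m n →
    (Fin m → ZFSet.{u}) → (Fin n → ZFSet.{u}) → Prop
  | _, _, .falsum, _, _ => False
  | _, _, .mem s t, a, b => Sum.elim a b s ∈ Sum.elim a b t
  | _, _, .eq s t, a, b => Sum.elim a b s = Sum.elim a b t
  | _, _, .imp φ ψ, a, b => φ.Sat A B a b → ψ.Sat A B a b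
  | _, _, .allFst φ, a, b => ∀ x ∈ A, φ.Sat A B (Fin.snoc (α := fun _ => ZFSet.{u}) a x) b
  | _, _, .allSnd φ, a, b => ∀ y ∈ B, φ.Sat A B a (Fin.snoc (α := fun _ => ZFSet.{u}) b y)

/-! ### The transitive collapse -/

/-- The collapsing map of `X`, given by `π x = {π y | y ∈ X, y ∈ x}`. It is not injective on `X`
unless `X` is extensional. -/
noncomputable def collapseMap (X x : ZFSet.{u}) : ZFSet.{u} :=
  haveI : Small.{u} {y : ZFSet.{u} // y ∈ x ∧ y ∈ X} :=
    small_of_injective (β := {y : ZFSet.{u} // y ∈ x}) (f := fun y => ⟨y.1, y.2.1⟩)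
      fun _ _ h => Subtype.ext (by simpa using h)
  ZFSet.range fun y : {y : ZFSet.{u} // y ∈ x ∧ y ∈ X} => collapseMap X y.1
termination_by x
decreasing_by exact y.2.1

theorem mem_collapseMap {X x z : ZFSet.{u}} :
    z ∈ collapseMap X x ↔ ∃ y, y ∈ x ∧ y ∈ X ∧ collapseMap X y = z := by
  rw [collapseMap]
  simp [ZFSet.mem_range, and_assoc]

/-- The transitive collapse of `X`, the image of `X` under its collapsing map. -/
noncomputable def transitiveCollapse (X : ZFSet.{u}) : ZFSet.{u} :=
  ZFSet.range fun y : {y : ZFSet.{u} // y ∈ X} => collapseMap X y.1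

theorem mem_transitiveCollapse {X z : ZFSet.{u}} :
    z ∈ transitiveCollapse X ↔ ∃ y, y ∈ X ∧ collapseMap X y = z := by
  simp [transitiveCollapse, ZFSet.mem_range]

/-! ### The reflection principle -/

/-- The level `V_ κ` satisfies reflection: whenever `l > κ` and a two-sorted formula holds in
`(V_ κ, V_ l)` of finitely many parameters, there are `α < κ` and `X ⊆ V_ l` of cardinality less
than `ℶ_ κ`, such that all parameters of the first sort lie in `V_ α` and all those of the second
sort in `X`, the transitive collapse of `X` is `V_ β` for some `β > α`, and the formula holds in
`(V_ α, X)` of the same parameters. -/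
def LevelReflects (κ : Ordinal.{u}) : Prop :=
  ∀ l : Ordinal.{u}, κ < l →
    ∀ (m n : ℕ) (φ : Formula m n) (a : Fin m → ZFSet.{u}) (b : Fin n → ZFSet.{u}),
      (∀ i, a i ∈ V_ κ) → (∀ i, b i ∈ V_ l) → φ.Sat (V_ κ) (V_ l) a b →
        ∃ α : Ordinal.{u}, α < κ ∧ ∃ X : ZFSet.{u}, X ⊆ V_ l ∧
          (∀ i, a i ∈ V_ α) ∧ (∀ i, b i ∈ X) ∧
          X.card < ℶ_ κ ∧
          (∃ β : Ordinal.{u}, α < β ∧ transitiveCollapse X = V_ β) ∧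
          φ.Sat (V_ α) X a b

/-! ### Supercompact cardinals -/

/-- `P_κ(A)`, the collection of all subsets of `A` of cardinality less than `κ`. -/
abbrev SmallSubset (κ : Cardinal.{u}) (A : Type u) : Type u :=
  {s : Set A // #s < κ}

/-- `U` is a normal measure on `P_κ(A)`: a `κ`-complete ultrafilter which is fine and such that
every function choosing an element of `s` for almost all `s` is constant on a set in `U`. -/
structure IsNormalMeasure (κ : Cardinal.{u}) (A : Type u)
    (U : Ultrafilter (SmallSubset κ A)) : Prop where
  complete : CardinalInterFilter (U : Filter (SmallSubset κ A)) κ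
  fine : ∀ x : A, ∀ᶠ s in (U : Filter (SmallSubset κ A)), x ∈ s.1
  normal : ∀ f : SmallSubset κ A → A,
    (∀ᶠ s in (U : Filter (SmallSubset κ A)), f s ∈ s.1) →
      ∃ x : A, ∀ᶠ s in (U : Filter (SmallSubset κ A)), f s = x

/-- An uncountable cardinal `κ` is supercompact if `P_κ(A)` carries a normal measure for every set
`A` of cardinality at least `κ`. -/
def IsSupercompact (κ : Cardinal.{u}) : Prop :=
  ℵ₀ < κ ∧ ∀ A : Type u, κ ≤ #A → ∃ U : Ultrafilter (SmallSubset κ A), IsNormalMeasure κ A U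

end LevelReflection

namespace LevelReflection

open Cardinal Filter

/-! ### Inaccessibility of supercompact cardinals -/

/-! From supercompactness to reflection: take a normal measure on the subsets of `V_ l` of size less
than κ. Normality gives Łoś's theorem directly for the structures `(s ∩ V_ κ, s)`, with no
ultrapower formed (`IsNormalFamily.sat_iff`), so φ passes to almost every `s`. For almost every `s`,
the trace on `V_ κ` is some `V_ α`, and every subset of a member of `s` has the same trace on `s` as
some member of `s` (`eventually_exists_inter_eq`), which makes the collapse a level `V_ β`. The size
bound is right because κ is inaccessible, so `ℶ_ κ` is κ.

From reflection to supercompactness: κ is first shown to be an uncountable cardinal with `ℶ_ κ ≤ κ`.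
If `P_κ(A)` had no normal measure, every family `W` of subsets of `P_κ(A)` would violate some
clause, and fewer than κ points, sets and functions witness this. Reflection gives a set `Y` of
fewer than κ such objects in which every subset of `Y` is the trace of a family whose witness lies
in `Y` (`exists_closed_set`). Let `s` be the set of points of `Y`, and take the trace to be the sets
in `Y` that contain `s`. On `Y` the resulting family looks like the principal ultrafilter at `s`,
which violates no clause. -/

theorem IsNormalMeasure.exists_nonprincipal {c : Cardinal.{u}} {A : Type u}
    {U : Ultrafilter (SmallSubset c A)} (hU : IsNormalMeasure c A U) (hA : c ≤ #A) :
    ∃ D : Ultrafilter A, CardinalInterFilter (D : Filter A) c ∧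
      ∀ x, ∀ᶠ y in (D : Filter A), y ≠ x := by
  have key : ∀ s : SmallSubset c A, ∃ x, x ∉ s.1 := by
    intro s
    by_contra! h
    have : s.1 = Set.univ := Set.eq_univ_of_forall h
    have h2 := s.2
    rw [this, mk_univ] at h2
    exact absurd h2 hA.not_gt
  choose f hf using key
  -- Push the measure forward along a choice of a point outside `s`; fineness makes the image
  -- nonprincipal.
  refine ⟨U.map f, ⟨fun S hS h => ?_⟩, fun x => ?_⟩
  · have := hU.complete
    rw [Ultrafilter.coe_map, Filter.mem_map, Set.preimage_sInter]
    exact (cardinal_bInter_mem hS).2 fun s hs => h s hs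
  · rw [Ultrafilter.coe_map, Filter.eventually_map]
    filter_upwards [hU.fine x] with s hs h
    exact hf s (h ▸ hs)

/-- A complete nonprincipal ultrafilter on `c` makes proper initial segments null, so fewer than `c`
of them cannot cover `c`. On the power set of some `x < c`, such an ultrafilter decides each
membership and so would concentrate on a single subset. -/
theorem IsSupercompact.isInaccessible {c : Cardinal.{u}} (hc : IsSupercompact c) :
    c.IsInaccessible := by
  refine ⟨hc.1, ?_, ?_⟩
  · rw [← Ordinal.cof_toType, Order.le_cof_iff]
    intro s hs
    by_contra! hlt
    obtain ⟨U, hU⟩ := hc.2 c.ord.ToType (by simp)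
    obtain ⟨D, hD, hne⟩ := hU.exists_nonprincipal (by simp)
    have h1 : ∀ i : s, ∀ᶠ x in (D : Filter c.ord.ToType), ¬ x ≤ i.1 := by
      intro i
      have hlt : #(Set.Iic i.1) < c := by
        have : NoMaxOrder c.ord.ToType := Cardinal.noMaxOrder hc.1.le
        obtain ⟨j, hj⟩ := exists_gt i.1
        have hlt := mk_Iio_lt j (by simp)
        rw [mk_toType, card_ord] at hlt
        exact (mk_le_mk_of_subset fun x hx => lt_of_le_of_lt hx hj).trans_lt hlt
      have := (eventually_cardinal_ball (l := (D : Filter c.ord.ToType)) hlt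
        (p := fun x y _ => x ≠ y)).2 fun y _ => hne y
      filter_upwards [this] with x hx h
      exact hx x h rfl
    obtain ⟨x, hx⟩ := ((eventually_cardinal_forall hlt).2 h1).exists
    obtain ⟨y, hy, hxy⟩ := hs x
    exact hx ⟨y, hy⟩ hxy
  · intro x hx
    by_contra! h
    have hA : c ≤ #(Set x.out) := by simpa using h
    obtain ⟨U, hU⟩ := hc.2 _ hA
    obtain ⟨D, hD, hne⟩ := hU.exists_nonprincipal hA
    let T : Set x.out := {i | ∀ᶠ S in (D : Filter (Set x.out)), i ∈ S}
    have h1 : ∀ i, ∀ᶠ S in (D : Filter (Set x.out)), (i ∈ S ↔ i ∈ T) := by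
      intro i
      by_cases hi : i ∈ T
      · filter_upwards [show ∀ᶠ S in (D : Filter (Set x.out)), i ∈ S from hi] with S hS
        simp [hS, hi]
      · filter_upwards [Ultrafilter.eventually_not.2
          (show ¬ ∀ᶠ S in (D : Filter (Set x.out)), i ∈ S from hi)] with S hS
        simp [hS, hi]
    have h2 := (eventually_cardinal_forall (by simpa using hx)).2 h1
    obtain ⟨S, hS, hST⟩ := (h2.and (hne T)).exists
    exact hST (Set.ext hS)

/-! ### Normal families of subsets of a set -/

/-- A normal ultrafilter on the subsets of `Y` of cardinality less than `c`, presented as an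
indexed family of sets. -/
structure IsNormalFamily (c : Cardinal.{u}) (Y : ZFSet.{u}) {I : Type u} (U : Ultrafilter I)
    (S : I → ZFSet.{u}) : Prop where
  complete : CardinalInterFilter (U : Filter I) c
  subset : ∀ i, S i ⊆ Y
  card_lt : ∀ i, (S i).card < c
  fine : ∀ x ∈ Y, ∀ᶠ i in (U : Filter I), x ∈ S i
  normal : ∀ f : I → ZFSet.{u}, (∀ᶠ i in (U : Filter I), f i ∈ S i) →
    ∃ x ∈ Y, ∀ᶠ i in (U : Filter I), f i = x

theorem IsSupercompact.exists_isNormalFamily {c : Cardinal.{u}} (hc : IsSupercompact c)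
    {Y : ZFSet.{u}} (hY : c ≤ Y.card) :
    ∃ (I : Type u) (U : Ultrafilter I) (S : I → ZFSet.{u}), IsNormalFamily c Y U S := by
  obtain ⟨U, hU⟩ := hc.2 (Shrink Y) hY
  let e := equivShrink Y
  refine ⟨_, U, fun s => ZFSet.range fun a : s.1 => (e.symm a.1).1, hU.complete, ?_, ?_, ?_, ?_⟩
  · intro s x hx
    obtain ⟨a, rfl⟩ := ZFSet.mem_range.1 hx
    exact (e.symm a.1).2
  · intro s
    have := ZFSet.lift_card_range_le (f := fun a : s.1 => (e.symm a.1).1)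
    rw [lift_id, lift_id] at this
    exact this.trans_lt s.2
  · intro x hx
    filter_upwards [hU.fine (e ⟨x, hx⟩)] with s hs
    exact ZFSet.mem_range.2 ⟨⟨_, hs⟩, by simp⟩
  · intro f hf
    have hne : Nonempty (Shrink Y) := by
      obtain ⟨s, hs⟩ := hf.exists
      obtain ⟨a, -⟩ := ZFSet.mem_range.1 hs
      exact ⟨a.1⟩
    have key : ∀ s : SmallSubset c (Shrink Y), ∃ a : Shrink Y,
        f s ∈ (ZFSet.range fun a : s.1 => (e.symm a.1).1) → a ∈ s.1 ∧ (e.symm a).1 = f s := by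
      intro s
      by_cases h : f s ∈ (ZFSet.range fun a : s.1 => (e.symm a.1).1)
      · obtain ⟨a, ha⟩ := ZFSet.mem_range.1 h
        exact ⟨a.1, fun _ => ⟨a.2, ha⟩⟩
      · exact ⟨hne.some, fun h' => absurd h' h⟩
    choose g hg using key
    obtain ⟨a, ha⟩ := hU.normal g (by filter_upwards [hf] with s hs using (hg s hs).1)
    refine ⟨(e.symm a).1, (e.symm a).2, ?_⟩
    filter_upwards [hf, ha] with s hs has
    rw [← (hg s hs).2, has]

namespace IsNormalFamily

variable {c : Cardinal.{u}} {Y : ZFSet.{u}} {I : Type u} {U : Ultrafilter I} {S : I → ZFSet.{u}}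

/-- Normality as closure under diagonal intersections: counterexamples chosen in `S i` would be
constant on a large set, which refutes the hypothesis at that one element. -/
theorem eventually_forall (hS : IsNormalFamily c Y U S) {p : I → ZFSet.{u} → Prop} :
    (∀ᶠ i in (U : Filter I), ∀ x ∈ S i, p i x) ↔ ∀ x ∈ Y, ∀ᶠ i in (U : Filter I), p i x := by
  refine ⟨fun h x hx => ?_, fun h => ?_⟩
  · filter_upwards [h, hS.fine x hx] with i hi hxi using hi x hxi
  · by_contra hcon
    rw [← Ultrafilter.eventually_not] at hcon
    have key : ∀ i, ∃ x, (¬ ∀ x ∈ S i, p i x) → x ∈ S i ∧ ¬ p i x := by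
      intro i
      by_cases hi : ∀ x ∈ S i, p i x
      · exact ⟨∅, fun h => absurd hi h⟩
      · push Not at hi
        obtain ⟨x, hx⟩ := hi
        exact ⟨x, fun _ => hx⟩
    choose f hf using key
    obtain ⟨x, hxY, hx⟩ := hS.normal f (by filter_upwards [hcon] with i hi using (hf i hi).1)
    obtain ⟨i, ⟨hi1, hi2⟩, hi3⟩ := ((hcon.and hx).and (h x hxY)).exists
    exact (hf i hi1).2 (hi2 ▸ hi3)

/-- Łoś's theorem for the normal ultrapower of `(K, Y)`. -/
theorem sat_iff (hS : IsNormalFamily c Y U S) {K : ZFSet.{u}} (hK : K ⊆ Y) :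
    ∀ {m n : ℕ} (φ : Formula m n) (a : Fin m → ZFSet.{u}) (b : Fin n → ZFSet.{u}),
      φ.Sat K Y a b ↔ ∀ᶠ i in (U : Filter I), φ.Sat (S i ∩ K) (S i) a b
  | _, _, .falsum, a, b => by simp [Formula.Sat, U.neBot.ne]
  | _, _, .mem s t, a, b => by simp [Formula.Sat]
  | _, _, .eq s t, a, b => by simp [Formula.Sat]
  | _, _, .imp φ ψ, a, b => by
    simp only [Formula.Sat]
    rw [Ultrafilter.eventually_imp, sat_iff hS hK φ, sat_iff hS hK ψ]
  | _, _, .allFst φ, a, b => by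
    simp only [Formula.Sat, ZFSet.mem_inter, and_imp]
    rw [hS.eventually_forall]
    refine ⟨fun h x _ => ?_, fun h x hx => ?_⟩
    · by_cases hxK : x ∈ K
      · filter_upwards [(sat_iff hS hK φ _ _).1 (h x hxK)] with i hi _ using hi
      · exact Eventually.of_forall fun _ h => absurd h hxK
    · rw [sat_iff hS hK φ]
      filter_upwards [h x (hK hx)] with i hi using hi hx
  | _, _, .allSnd φ, a, b => by
    simp only [Formula.Sat]
    rw [hS.eventually_forall]
    exact forall₂_congr fun x _ => sat_iff hS hK φ _ _

/-- The members of a normal family are closed under subsets in the sense of the structure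
`(S i, ∈)`. -/
theorem eventually_exists_inter_eq (hS : IsNormalFamily c Y U S)
    (hY : ∀ x ∈ Y, ∀ z, z ⊆ x → z ∈ Y) :
    ∀ᶠ i in (U : Filter I), ∀ x ∈ S i, ∀ Z, Z ⊆ x →
      ∃ z ∈ S i, z ⊆ x ∧ ∀ w ∈ S i, (w ∈ z ↔ w ∈ Z) := by
  rw [hS.eventually_forall]
  intro x hx
  by_contra hcon
  rw [← Ultrafilter.eventually_not] at hcon
  have key : ∀ i, ∃ Z, (¬ ∀ Z, Z ⊆ x → ∃ z ∈ S i, z ⊆ x ∧ ∀ w ∈ S i, (w ∈ z ↔ w ∈ Z)) →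
      Z ⊆ x ∧ ¬ ∃ z ∈ S i, z ⊆ x ∧ ∀ w ∈ S i, (w ∈ z ↔ w ∈ Z) := by
    intro i
    by_cases h : ∀ Z, Z ⊆ x → ∃ z ∈ S i, z ⊆ x ∧ ∀ w ∈ S i, (w ∈ z ↔ w ∈ Z)
    · exact ⟨∅, fun h' => absurd h h'⟩
    · rw [not_forall] at h
      obtain ⟨Z, hZ⟩ := h
      exact ⟨Z, fun _ => by rwa [Classical.not_imp] at hZ⟩
  choose Z hZ using key
  -- The ultrafilter limit of the bad subsets `Z i`; it lies in `Y`, hence in almost all `S i`, and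
  -- has the same trace there as `Z i`.
  let z := ZFSet.sep (fun y => ∀ᶠ i in (U : Filter I), y ∈ Z i) x
  have hzx : z ⊆ x := ZFSet.sep_subset
  have hz : ∀ᶠ i in (U : Filter I), ∀ w ∈ S i, (w ∈ z ↔ w ∈ Z i) := by
    rw [hS.eventually_forall]
    intro w _
    by_cases hwx : w ∈ x
    · by_cases hw : ∀ᶠ i in (U : Filter I), w ∈ Z i
      · filter_upwards [hw] with i hi
        simp [z, hwx, hw, hi]
      · filter_upwards [Ultrafilter.eventually_not.2 hw] with i hi
        simp [z, hw, hi]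
    · filter_upwards [hcon] with i hi
      exact ⟨fun h => absurd (hzx h) hwx, fun h => absurd ((hZ i hi).1 h) hwx⟩
  obtain ⟨i, ⟨hi1, hi2⟩, hi3⟩ := ((hcon.and hz).and (hS.fine z (hY x hx z hzx))).exists
  exact (hZ i hi1).2 ⟨z, hi3, hzx, hi2⟩

end IsNormalFamily

/-! ### Collapses onto levels of the cumulative hierarchy -/

theorem eq_vonNeumann_rank {W : ZFSet.{u}}
    (h : ∀ y ∈ W, ∀ z : ZFSet.{u}, z.rank ≤ y.rank → z ∈ W) : W = V_ W.rank := by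
  ext z
  rw [ZFSet.mem_vonNeumann]
  refine ⟨ZFSet.rank_lt_of_mem, fun hz => ?_⟩
  obtain ⟨y, hy, hzy⟩ := ZFSet.lt_rank_iff.1 hz
  exact h y hy z hzy

theorem collapseMap_eq_self {X W : ZFSet.{u}} (hW : W.IsTransitive) (hWX : W ⊆ X) :
    ∀ x ∈ W, collapseMap X x = x := by
  intro x
  induction x using ZFSet.inductionOn with
  | _ x ih =>
    intro hx
    ext z
    rw [mem_collapseMap]
    constructor
    · rintro ⟨y, hyx, -, rfl⟩
      rwa [ih y hyx (hW x hx hyx)]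
    · intro hz
      exact ⟨z, hz, hWX (hW x hx hz), ih z hz (hW x hx hz)⟩

section Collapse

variable {X : ZFSet.{u}} (hrank : ∀ x ∈ X, V_ x.rank ∈ X)
  (hsub : ∀ x ∈ X, ∀ Z, Z ⊆ x → ∃ z ∈ X, z ⊆ x ∧ ∀ w ∈ X, (w ∈ z ↔ w ∈ Z))

-- A subset of the collapse pulls back to a subset of `x`, which `hsub` replaces by a member of `X`
-- with the same trace. Injectivity of the collapse is not needed.
include hsub in
theorem subset_collapseMap_iff {x : ZFSet.{u}} (hx : x ∈ X) (y : ZFSet.{u}) :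
    y ⊆ collapseMap X x ↔ ∃ z ∈ X, z ⊆ x ∧ collapseMap X z = y := by
  constructor
  · intro hy
    obtain ⟨z, hzX, hzx, hz⟩ := hsub x hx (ZFSet.sep (fun w => collapseMap X w ∈ y) x)
      ZFSet.sep_subset
    refine ⟨z, hzX, hzx, ?_⟩
    ext v
    rw [mem_collapseMap]
    constructor
    · rintro ⟨w, hwz, hwX, rfl⟩
      exact (ZFSet.mem_sep.1 ((hz w hwX).1 hwz)).2
    · intro hv
      obtain ⟨w, hwx, hwX, rfl⟩ := mem_collapseMap.1 (hy hv)
      exact ⟨w, (hz w hwX).2 (ZFSet.mem_sep.2 ⟨hwx, hv⟩), hwX, rfl⟩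
  · rintro ⟨z, -, hzx, rfl⟩ v hv
    obtain ⟨w, hwz, hwX, rfl⟩ := mem_collapseMap.1 hv
    exact mem_collapseMap.2 ⟨w, hzx hwz, hwX, rfl⟩

-- By induction the level `V_ w.rank` of a member `w` collapses to some `V_ δ`. Anything of rank at
-- most that of the collapse of `w` is a subset of `V_ δ`, hence the collapse of a subset of `V_
-- w.rank`, which again lies in `V_ γ`.
include hrank hsub in
theorem exists_collapseMap_vonNeumann_eq (γ : Ordinal.{u}) (hγ : V_ γ ∈ X) :
    ∃ δ : Ordinal.{u}, collapseMap X (V_ γ) = V_ δ := by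
  induction γ using WellFoundedLT.induction with
  | _ γ ih =>
    refine ⟨_, eq_vonNeumann_rank fun y hy v hv => ?_⟩
    obtain ⟨w, hwγ, hwX, rfl⟩ := mem_collapseMap.1 hy
    have hlt := ZFSet.mem_vonNeumann.1 hwγ
    obtain ⟨δ, hδ⟩ := ih _ hlt (hrank w hwX)
    have h1 : collapseMap X w ⊆ V_ δ :=
      hδ ▸ (subset_collapseMap_iff hsub (hrank w hwX) _).2
        ⟨w, hwX, ZFSet.subset_vonNeumann_self w, rfl⟩
    have h2 : v ⊆ collapseMap X (V_ w.rank) := by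
      rw [hδ, ZFSet.subset_vonNeumann]
      exact hv.trans (ZFSet.subset_vonNeumann.1 h1)
    obtain ⟨z, hzX, hz, rfl⟩ := (subset_collapseMap_iff hsub (hrank w hwX) _).1 h2
    refine mem_collapseMap.2 ⟨z, ?_, hzX, rfl⟩
    exact ZFSet.mem_vonNeumann.2 ((ZFSet.subset_vonNeumann.1 hz).trans_lt hlt)

include hrank hsub in
theorem exists_transitiveCollapse_eq_vonNeumann :
    ∃ β : Ordinal.{u}, transitiveCollapse X = V_ β := by
  refine ⟨_, eq_vonNeumann_rank fun y hy v hv => ?_⟩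
  obtain ⟨w, hwX, rfl⟩ := mem_transitiveCollapse.1 hy
  obtain ⟨δ, hδ⟩ := exists_collapseMap_vonNeumann_eq hrank hsub _ (hrank w hwX)
  have h1 : collapseMap X w ⊆ V_ δ :=
    hδ ▸ (subset_collapseMap_iff hsub (hrank w hwX) _).2
      ⟨w, hwX, ZFSet.subset_vonNeumann_self w, rfl⟩
  have h2 : v ⊆ collapseMap X (V_ w.rank) := by
    rw [hδ, ZFSet.subset_vonNeumann]
    exact hv.trans (ZFSet.subset_vonNeumann.1 h1)
  obtain ⟨z, hzX, -, rfl⟩ := (subset_collapseMap_iff hsub (hrank w hwX) _).1 h2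
  exact mem_transitiveCollapse.2 ⟨z, hzX, rfl⟩

end Collapse

theorem IsSupercompact.levelReflects {c : Cardinal.{u}} (hc : IsSupercompact c) :
    LevelReflects c.ord := by
  intro l hl m n φ a b ha hb hφ
  have hin := hc.isInaccessible
  have hKY : V_ c.ord ⊆ V_ l := ZFSet.vonNeumann_subset_of_le hl.le
  have hcK : c ≤ (V_ c.ord).card := by simpa using c.ord.card_le_card_vonNeumann
  obtain ⟨I, U, S, hS⟩ := hc.exists_isNormalFamily (hcK.trans (ZFSet.card_mono hKY))
  have := hS.complete
  have hsat := (hS.sat_iff hKY φ a b).1 hφ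
  have hsub := hS.eventually_exists_inter_eq
    fun x hx z hz => ZFSet.mem_vonNeumann_of_subset hz hx
  have hrank : ∀ᶠ i in (U : Filter I), ∀ x ∈ S i, V_ x.rank ∈ S i :=
    hS.eventually_forall.2 fun x hx => hS.fine _ (by simpa [ZFSet.mem_vonNeumann] using hx)
  -- The successor matters: `V_ (x.rank + 1)` contains every set of rank at most that of `x`.
  have hrankK : ∀ᶠ i in (U : Filter I), ∀ x ∈ S i, x ∈ V_ c.ord → V_ (x.rank + 1) ∈ S i := by
    refine hS.eventually_forall.2 fun x _ => ?_
    by_cases hx : x ∈ V_ c.ord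
    · have hlt := ZFSet.mem_vonNeumann.1 hx
      filter_upwards [hS.fine (V_ (x.rank + 1)) (hKY (ZFSet.vonNeumann_mem_of_lt
        ((Cardinal.isSuccLimit_ord hc.1.le).add_one_lt hlt)))] with i hi _ using hi
    · exact Eventually.of_forall fun _ h => absurd h hx
  -- By inaccessibility such an `x` has fewer than `c` elements, so completeness combines the
  -- instances of fineness.
  have htrans : ∀ᶠ i in (U : Filter I), ∀ x ∈ S i, x ∈ V_ c.ord → x ⊆ S i := by
    refine hS.eventually_forall.2 fun x _ => ?_
    by_cases hx : x ∈ V_ c.ord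
    · have hcard : x.card < c := by
        rw [ZFSet.mem_vonNeumann] at hx
        refine (ZFSet.card_mono (ZFSet.subset_vonNeumann_self x)).trans_lt ?_
        rw [ZFSet.card_vonNeumann, ← hin.preBeth_ord]
        exact preBeth_strictMono hx
      have := (eventually_cardinal_forall (l := (U : Filter I)) (ι := Shrink x)
        (p := fun i y => ((equivShrink x).symm y).1 ∈ S i) hcard).2
        fun y => hS.fine _ (hKY (ZFSet.isTransitive_vonNeumann _ x hx ((equivShrink x).symm y).2))
      filter_upwards [this] with i hi _ y hy
      simpa using hi (equivShrink x ⟨y, hy⟩)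
    · exact Eventually.of_forall fun _ h => absurd h hx
  have hfa : ∀ᶠ i in (U : Filter I), ∀ j, a j ∈ S i :=
    eventually_all.2 fun j => hS.fine _ (hKY (ha j))
  have hfb : ∀ᶠ i in (U : Filter I), ∀ j, b j ∈ S i :=
    eventually_all.2 fun j => hS.fine _ (hb j)
  have hfK := hS.fine (V_ c.ord) (ZFSet.vonNeumann_mem_of_lt hl)
  obtain ⟨i, hsat, hsub, hrank, hrankK, htrans, hfa, hfb, hfK⟩ :=
    (hsat.and <| hsub.and <| hrank.and <| hrankK.and <| htrans.and <| hfa.and <|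
      hfb.and hfK).exists
  have hα : S i ∩ V_ c.ord = V_ (S i ∩ V_ c.ord).rank := by
    refine eq_vonNeumann_rank fun y hy z hz => ?_
    rw [ZFSet.mem_inter] at hy ⊢
    have hrk := ZFSet.mem_vonNeumann.1 hy.2
    refine ⟨htrans _ (hrankK y hy.1 hy.2) ?_ ?_, ZFSet.mem_vonNeumann.2 (hz.trans_lt hrk)⟩
    · exact ZFSet.vonNeumann_mem_of_lt ((Cardinal.isSuccLimit_ord hc.1.le).add_one_lt hrk)
    · exact ZFSet.mem_vonNeumann.2 (hz.trans_lt (by simp))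
  generalize (S i ∩ V_ c.ord).rank = α at hα
  have hαS : V_ α ⊆ S i := hα ▸ fun x hx => (ZFSet.mem_inter.1 hx).1
  have hακ : α < c.ord := by
    by_contra! h
    exact (hcK.trans (ZFSet.card_mono ((ZFSet.vonNeumann_subset_of_le h).trans hαS))).not_gt
      (hS.card_lt i)
  obtain ⟨β, hβ⟩ := exists_transitiveCollapse_eq_vonNeumann hrank hsub
  refine ⟨α, hακ, S i, hS.subset i, fun j => hα ▸ ZFSet.mem_inter.2 ⟨hfa j, ha j⟩, hfb,
    hin.beth_ord.symm ▸ hS.card_lt i, ⟨β, ?_, hβ⟩, hα ▸ hsat⟩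
  -- As a member of `S i`, `V_ c.ord` collapses to its trace; hence `V_ α` is in `V_ β` and `α < β`.
  have hcol : collapseMap (S i) (V_ c.ord) = V_ α := by
    have hself := collapseMap_eq_self (ZFSet.isTransitive_vonNeumann α) hαS
    ext z
    rw [mem_collapseMap]
    constructor
    · rintro ⟨y, hyK, hyS, rfl⟩
      have hy : y ∈ V_ α := hα ▸ ZFSet.mem_inter.2 ⟨hyS, hyK⟩
      rwa [hself y hy]
    · intro hz
      have hz' := hz
      rw [← hα, ZFSet.mem_inter] at hz'
      exact ⟨z, hz'.2, hz'.1, hself z hz⟩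
  rw [← ZFSet.vonNeumann_mem_vonNeumann_iff, ← hβ, ← hcol]
  exact mem_transitiveCollapse.2 ⟨_, hfK, rfl⟩

/-! ### Derived connectives -/

namespace Formula

variable {m n : ℕ}

def neg (φ : Formula m n) : Formula m n := .imp φ .falsum

def conj (φ ψ : Formula m n) : Formula m n := neg (.imp φ (neg ψ))

def exFst (φ : Formula (m + 1) n) : Formula m n := neg (.allFst (neg φ))

def exSnd (φ : Formula m (n + 1)) : Formula m n := neg (.allSnd (neg φ))

variable (A B : ZFSet.{u}) (a : Fin m → ZFSet.{u}) (b : Fin n → ZFSet.{u})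

@[simp]
theorem sat_falsum : (falsum : Formula m n).Sat A B a b ↔ False := Iff.rfl

@[simp]
theorem sat_mem (s t : Fin m ⊕ Fin n) :
    (mem s t).Sat A B a b ↔ Sum.elim a b s ∈ Sum.elim a b t := Iff.rfl

@[simp]
theorem sat_eq (s t : Fin m ⊕ Fin n) :
    (eq s t).Sat A B a b ↔ Sum.elim a b s = Sum.elim a b t := Iff.rfl

@[simp]
theorem sat_imp (φ ψ : Formula m n) :
    (imp φ ψ).Sat A B a b ↔ (φ.Sat A B a b → ψ.Sat A B a b) := Iff.rfl

@[simp]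
theorem sat_allFst (φ : Formula (m + 1) n) : (allFst φ).Sat A B a b ↔
    ∀ x ∈ A, φ.Sat A B (Fin.snoc (α := fun _ => ZFSet.{u}) a x) b := Iff.rfl

@[simp]
theorem sat_allSnd (φ : Formula m (n + 1)) : (allSnd φ).Sat A B a b ↔
    ∀ y ∈ B, φ.Sat A B a (Fin.snoc (α := fun _ => ZFSet.{u}) b y) := Iff.rfl

@[simp]
theorem sat_neg (φ : Formula m n) : (neg φ).Sat A B a b ↔ ¬ φ.Sat A B a b := Iff.rfl

@[simp]
theorem sat_conj (φ ψ : Formula m n) :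
    (conj φ ψ).Sat A B a b ↔ φ.Sat A B a b ∧ ψ.Sat A B a b := by
  simp [conj]

@[simp]
theorem sat_exFst (φ : Formula (m + 1) n) : (exFst φ).Sat A B a b ↔
    ∃ x ∈ A, φ.Sat A B (Fin.snoc (α := fun _ => ZFSet.{u}) a x) b := by
  simp [exFst]

@[simp]
theorem sat_exSnd (φ : Formula m (n + 1)) : (exSnd φ).Sat A B a b ↔
    ∃ y ∈ B, φ.Sat A B a (Fin.snoc (α := fun _ => ZFSet.{u}) b y) := by
  simp [exSnd]

end Formula

/-! ### Closure properties of reflecting levels -/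

open Formula

namespace LevelReflects

variable {κ : Ordinal.{u}}

/-- Reflect a tautology with parameter `x`. -/
theorem exists_lt_of_mem (h : LevelReflects κ) {x : ZFSet.{u}} (hx : x ∈ V_ κ) :
    ∃ α < κ, x ∈ V_ α := by
  obtain ⟨α, hα, X, -, ha, -⟩ := h (κ + 1) (by simp) 1 0 (.neg .falsum) (fun _ => x) Fin.elim0
    (fun _ => hx) (fun i => i.elim0) (by simp)
  exact ⟨α, hα, ha 0⟩

theorem omega0_lt (h : LevelReflects κ) : Ordinal.omega0.{u} < κ := by
  have hpos : 0 < κ := by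
    obtain ⟨α, hα, -⟩ := h (κ + 1) (by simp) 0 0 (.neg .falsum) Fin.elim0 Fin.elim0
      (fun i => i.elim0) (fun i => i.elim0) (by simp)
    exact hα.bot_lt
  -- The reflected sentence says that the first sort is nonempty and each element belongs to
  -- another; in `V_ α` this forces α above every natural number.
  obtain ⟨α, hα, X, -, -, -, -, -, hsat⟩ := h (κ + 1) (by simp) 0 0
    (.conj (.exFst (.neg .falsum))
      (.allFst (.exFst (.mem (.inl (Fin.last 0).castSucc) (.inl (Fin.last 1))))))
    Fin.elim0 Fin.elim0 (fun i => i.elim0) (fun i => i.elim0) (by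
      simp only [sat_conj, sat_exFst, sat_neg, sat_falsum, sat_allFst, sat_mem, Sum.elim_inl,
        Fin.snoc_castSucc, Fin.snoc_last]
      refine ⟨⟨∅, by simpa [ZFSet.mem_vonNeumann] using hpos, by simp⟩, fun x hx => ?_⟩
      obtain ⟨α, hα, hx⟩ := h.exists_lt_of_mem hx
      exact ⟨V_ α, ZFSet.vonNeumann_mem_of_lt hα, hx⟩)
  simp only [sat_conj, sat_exFst, sat_neg, sat_falsum, sat_allFst, sat_mem, Sum.elim_inl,
    Fin.snoc_castSucc, Fin.snoc_last] at hsat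
  refine lt_of_le_of_lt (Ordinal.omega0_le.2 fun n => ?_) hα
  suffices (n : Ordinal.{u}) < α from this.le
  induction n with
  | zero =>
    obtain ⟨x, hx, -⟩ := hsat.1
    exact_mod_cast (ZFSet.mem_vonNeumann.1 hx).bot_lt
  | succ n ih =>
    obtain ⟨y, hy, hny⟩ := hsat.2 _ (ZFSet.vonNeumann_mem_of_lt ih)
    rw [ZFSet.mem_vonNeumann] at hy
    have := ZFSet.rank_lt_of_mem hny
    rw [ZFSet.rank_vonNeumann] at this
    push_cast
    exact (Order.add_one_le_of_lt this).trans_lt hy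

theorem isSuccLimit (h : LevelReflects κ) : Order.IsSuccLimit κ := by
  refine Ordinal.isSuccLimit_iff.2 ⟨(Ordinal.omega0_pos.trans h.omega0_lt).ne', ?_⟩
  refine Order.isSuccPrelimit_of_succ_lt fun δ hδ => ?_
  obtain ⟨α, hα, hx⟩ := h.exists_lt_of_mem (ZFSet.vonNeumann_mem_of_lt hδ)
  exact (Order.succ_le_of_lt (ZFSet.vonNeumann_mem_vonNeumann_iff.1 hx)).trans_lt hα

theorem pair_mem (h : LevelReflects κ) {x y : ZFSet.{u}} (hx : x ∈ V_ κ) (hy : y ∈ V_ κ) :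
    ({x, y} : ZFSet.{u}) ∈ V_ κ := by
  rw [ZFSet.mem_vonNeumann] at *
  rw [ZFSet.rank_pair]
  exact max_lt (h.isSuccLimit.succ_lt hx) (h.isSuccLimit.succ_lt hy)

/-- Functions from an element of `V_ κ` to `V_ κ` are bounded. -/
theorem exists_forall_mem (h : LevelReflects κ) {d : ZFSet.{u}} (hd : d ∈ V_ κ)
    (f : ZFSet.{u} → ZFSet.{u}) (hf : ∀ x ∈ d, f x ∈ V_ κ) :
    ∃ α < κ, ∀ x ∈ d, f x ∈ V_ α := by
  -- The graph of `f`. By foundation `{d, f x}` is not in `d`, so `x` is the only element of its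
  -- code lying in `d`. Transitivity of `V_ α` then extracts `f x` from the code.
  let F : ZFSet.{u} := ZFSet.range fun x : d => {x.1, {d, f x.1}}
  have hF : ∀ p, p ∈ F ↔ ∃ x ∈ d, {x, {d, f x}} = p := by
    intro p
    simp [F, ZFSet.mem_range]
  have hdκ : ∀ x ∈ d, x ∈ V_ κ := fun x hx => ZFSet.isTransitive_vonNeumann κ d hd hx
  have hp : ∀ x ∈ d, ({x, {d, f x}} : ZFSet.{u}) ∈ V_ κ := fun x hx =>
    h.pair_mem (hdκ x hx) (h.pair_mem hd (hf x hx))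
  obtain ⟨α, hα, X, -, ha, -, -, -, hsat⟩ := h (κ + 1) (by simp) 1 1
    (.allFst (.imp (.mem (.inl (Fin.last 1)) (.inl (Fin.last 0).castSucc))
      (.exFst (.conj (.mem (.inl (Fin.last 2)) (.inr 0))
        (.mem (.inl (Fin.last 1).castSucc) (.inl (Fin.last 2)))))))
    (fun _ => d) (fun _ => F) (fun _ => hd)
    (fun _ => by
      rw [ZFSet.vonNeumann_add_one, ZFSet.mem_powerset]
      intro p hpF
      obtain ⟨x, hx, rfl⟩ := (hF p).1 hpF
      exact hp x hx)
    (by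
      simp only [sat_conj, sat_exFst, sat_imp, sat_allFst, sat_mem, Sum.elim_inl, Sum.elim_inr,
        Fin.snoc_castSucc, Fin.snoc_last]
      intro x _ hx
      exact ⟨_, hp x hx, (hF _).2 ⟨x, hx, rfl⟩, by simp⟩)
  simp only [sat_conj, sat_exFst, sat_imp, sat_allFst, sat_mem, Sum.elim_inl, Sum.elim_inr,
    Fin.snoc_castSucc, Fin.snoc_last] at hsat
  refine ⟨α, hα, fun x hx => ?_⟩
  have htr := ZFSet.isTransitive_vonNeumann α
  obtain ⟨p, hpα, hpF, hxp⟩ := hsat x (htr _ (ha 0) hx) hx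
  obtain ⟨y, hy, rfl⟩ := (hF p).1 hpF
  rw [ZFSet.mem_pair] at hxp
  rcases hxp with rfl | rfl
  · exact htr _ (htr _ hpα (ZFSet.mem_pair.2 (Or.inr rfl))) (ZFSet.mem_pair.2 (Or.inr rfl))
  · exact absurd (ZFSet.mem_pair.2 (Or.inl rfl)) (ZFSet.mem_asymm hx)

/-- Otherwise κ injects into `d`, and inverting the injection gives an unbounded map from `d` to κ.
-/
theorem card_lt (h : LevelReflects κ) {d : ZFSet.{u}} (hd : d ∈ V_ κ) : d.card < κ.card := by
  by_contra! hle
  rw [← mk_toType, ZFSet.card] at hle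
  obtain ⟨e⟩ := hle
  let E : Set.Iio κ → ZFSet.{u} := fun o => ((equivShrink d).symm (e (Ordinal.ToType.mk o))).1
  have hE : Function.Injective E := fun o o' ho => by
    simpa using (Subtype.ext ho : (equivShrink d).symm (e (Ordinal.ToType.mk o)) =
      (equivShrink d).symm (e (Ordinal.ToType.mk o')))
  have : Nonempty (Set.Iio κ) := ⟨⟨0, Ordinal.omega0_pos.trans h.omega0_lt⟩⟩
  obtain ⟨α, hα, hb⟩ := h.exists_forall_mem hd
    (fun x => (Function.invFun E x).1.toZFSet)
    (fun x _ => by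
      rw [ZFSet.mem_vonNeumann, Ordinal.rank_toZFSet]
      exact (Function.invFun E x).2)
  have := hb (E ⟨α, hα⟩) (((equivShrink d).symm (e (Ordinal.ToType.mk ⟨α, hα⟩))).2)
  rw [Function.leftInverse_invFun hE, ZFSet.mem_vonNeumann, Ordinal.rank_toZFSet] at this
  exact lt_irrefl _ this

theorem ord_card (h : LevelReflects κ) : κ.card.ord = κ := by
  refine (ord_card_le κ).eq_of_not_lt fun hlt => ?_
  have := h.card_lt (d := κ.card.ord.toZFSet) (by simpa [ZFSet.mem_vonNeumann] using hlt)
  simp at this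

theorem aleph0_lt_card (h : LevelReflects κ) : ℵ₀ < κ.card := by
  rw [← ord_lt_ord, h.ord_card, ord_aleph0]
  exact h.omega0_lt

/-- For `γ < κ`, `ℶ_ γ` is the size of `V_ (ω + γ)`, and `ω + γ < κ` because κ is additively
indecomposable. -/
theorem beth_le_card (h : LevelReflects κ) : ℶ_ κ ≤ κ.card := by
  rw [beth_limit h.isSuccLimit]
  refine ciSup_le' fun γ => ?_
  rw [beth_eq_preBeth, ← ZFSet.card_vonNeumann]
  refine (h.card_lt (ZFSet.vonNeumann_mem_of_lt ?_)).le
  have := Ordinal.isPrincipal_add_ord h.aleph0_lt_card.le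
  rw [h.ord_card] at this
  exact this h.omega0_lt γ.2

end LevelReflects

/-! ### The subsets of elements of a collapsible set -/

theorem collapseMap_injOn {X : ZFSet.{u}}
    (hext : ∀ x ∈ X, ∀ y ∈ X, (∀ z ∈ X, (z ∈ x ↔ z ∈ y)) → x = y) :
    ∀ x ∈ X, ∀ y ∈ X, collapseMap X x = collapseMap X y → x = y := by
  intro x
  induction x using ZFSet.inductionOn with
  | _ x ih =>
    intro hx y hy hxy
    refine hext x hx y hy fun z hz => ⟨fun hzx => ?_, fun hzy => ?_⟩
    · have : collapseMap X z ∈ collapseMap X y := hxy ▸ mem_collapseMap.2 ⟨z, hzx, hz, rfl⟩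
      obtain ⟨w, hwy, hw, hwz⟩ := mem_collapseMap.1 this
      rwa [ih z hzx hz w hw hwz.symm]
    · have : collapseMap X z ∈ collapseMap X x := hxy ▸ mem_collapseMap.2 ⟨z, hzy, hz, rfl⟩
      obtain ⟨w, hwx, hw, hwz⟩ := mem_collapseMap.1 this
      rwa [← ih w hwx hw z hz hwz]

/-- `V_ β` is closed under subsets, so the image of `Z` is the collapse of a member of `X`;
injectivity transfers this back. -/
theorem exists_inter_eq_of_transitiveCollapse {X : ZFSet.{u}}
    (hext : ∀ x ∈ X, ∀ y ∈ X, (∀ z ∈ X, (z ∈ x ↔ z ∈ y)) → x = y) {β : Ordinal.{u}}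
    (hβ : transitiveCollapse X = V_ β) {x : ZFSet.{u}} (hx : x ∈ X) (Z : Set ZFSet.{u})
    (hZ : ∀ w ∈ Z, w ∈ x ∧ w ∈ X) : ∃ z ∈ X, ∀ w ∈ X, (w ∈ z ↔ w ∈ Z) := by
  have hinj := collapseMap_injOn hext
  have h0 : ZFSet.sep (fun v => ∃ w ∈ Z, collapseMap X w = v) (collapseMap X x) ∈ V_ β :=
    ZFSet.mem_vonNeumann_of_subset ZFSet.sep_subset
      (hβ ▸ mem_transitiveCollapse.2 ⟨x, hx, rfl⟩)
  rw [← hβ, mem_transitiveCollapse] at h0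
  obtain ⟨z, hz, hzv⟩ := h0
  refine ⟨z, hz, fun w hw => ⟨fun hwz => ?_, fun hwZ => ?_⟩⟩
  · have : collapseMap X w ∈ collapseMap X z := mem_collapseMap.2 ⟨w, hwz, hw, rfl⟩
    rw [hzv, ZFSet.mem_sep] at this
    obtain ⟨w', hw', hww'⟩ := this.2
    rwa [← hinj w' (hZ w' hw').2 w hw hww']
  · have : collapseMap X w ∈ collapseMap X z := by
      rw [hzv, ZFSet.mem_sep]
      exact ⟨mem_collapseMap.2 ⟨w, (hZ w hwZ).1, hw, rfl⟩, w, hwZ, rfl⟩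
    obtain ⟨w', hw'z, hw', hww'⟩ := mem_collapseMap.1 this
    rwa [← hinj w' hw' w hw hww']

/-! ### Expressing closure under a binary function -/

/-- Some element of `p` contains both `t` and `x`. -/
def slot {m n : ℕ} (t x p : Fin n) : Formula m n :=
  .exSnd (.conj (.mem (.inr (Fin.last n)) (.inr p.castSucc))
    (.conj (.mem (.inr t.castSucc) (.inr (Fin.last n)))
      (.mem (.inr x.castSucc) (.inr (Fin.last n)))))

theorem sat_slot {m n : ℕ} (t x p : Fin n) (A B : ZFSet.{u}) (a : Fin m → ZFSet.{u})
    (b : Fin n → ZFSet.{u}) :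
    (slot t x p).Sat A B a b ↔ ∃ s ∈ B, s ∈ b p ∧ b t ∈ s ∧ b x ∈ s := by
  simp [slot]

/-- `B` is closed under the binary function on `M` whose graph is coded by `F` with tags
`t₀`, `t₁`, `t₂`. -/
def IsClosedUnder (B M t₀ t₁ t₂ F : ZFSet.{u}) : Prop :=
  ∀ x ∈ B, x ∈ M → ∀ y ∈ B, y ∈ M → ∃ z ∈ B, z ∈ M ∧ ∃ p ∈ B, p ∈ F ∧
    (∃ s ∈ B, s ∈ p ∧ t₀ ∈ s ∧ x ∈ s) ∧ (∃ s ∈ B, s ∈ p ∧ t₁ ∈ s ∧ y ∈ s) ∧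
      ∃ s ∈ B, s ∈ p ∧ t₂ ∈ s ∧ z ∈ s

def closedUnder {m n : ℕ} (M t₀ t₁ t₂ F : Fin n) : Formula m n :=
  .allSnd (.imp (.mem (.inr (Fin.last n)) (.inr M.castSucc))
    (.allSnd (.imp (.mem (.inr (Fin.last (n + 1))) (.inr M.castSucc.castSucc))
      (.exSnd (.conj (.mem (.inr (Fin.last (n + 2))) (.inr M.castSucc.castSucc.castSucc))
        (.exSnd (.conj (.mem (.inr (Fin.last (n + 3)))
            (.inr F.castSucc.castSucc.castSucc.castSucc))
          (.conj (slot t₀.castSucc.castSucc.castSucc.castSucc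
              (Fin.last n).castSucc.castSucc.castSucc (Fin.last (n + 3)))
            (.conj (slot t₁.castSucc.castSucc.castSucc.castSucc
                (Fin.last (n + 1)).castSucc.castSucc (Fin.last (n + 3)))
              (slot t₂.castSucc.castSucc.castSucc.castSucc
                (Fin.last (n + 2)).castSucc (Fin.last (n + 3))))))))))))

theorem sat_closedUnder {m n : ℕ} (M t₀ t₁ t₂ F : Fin n) (A B : ZFSet.{u})
    (a : Fin m → ZFSet.{u}) (b : Fin n → ZFSet.{u}) :
    (closedUnder M t₀ t₁ t₂ F).Sat A B a b ↔
      IsClosedUnder B (b M) (b t₀) (b t₁) (b t₂) (b F) := by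
  simp [closedUnder, sat_slot, IsClosedUnder]

/-- A code for the restriction of `g` to `M`. -/
noncomputable def graphCode (M t₀ t₁ t₂ : ZFSet.{u}) (g : ZFSet.{u} → ZFSet.{u} → ZFSet.{u}) :
    ZFSet.{u} :=
  ZFSet.range fun x : M × M => {{x.1.1, t₀}, {x.2.1, t₁}, {g x.1.1 x.2.1, t₂}}

theorem mem_graphCode {M t₀ t₁ t₂ p : ZFSet.{u}} {g : ZFSet.{u} → ZFSet.{u} → ZFSet.{u}} :
    p ∈ graphCode M t₀ t₁ t₂ g ↔
      ∃ x ∈ M, ∃ y ∈ M, p = {{x, t₀}, {y, t₁}, {g x y, t₂}} := by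
  simp only [graphCode, ZFSet.mem_range, Prod.exists, Subtype.exists, exists_prop, eq_comm]

section GraphCode

variable {M t₀ t₁ t₂ : ZFSet.{u}} {g : ZFSet.{u} → ZFSet.{u} → ZFSet.{u}}

theorem isClosedUnder_graphCode (hg : ∀ x ∈ M, ∀ y ∈ M, g x y ∈ M) {B : ZFSet.{u}}
    (hB : B.IsTransitive) (hF : graphCode M t₀ t₁ t₂ g ∈ B) :
    IsClosedUnder B M t₀ t₁ t₂ (graphCode M t₀ t₁ t₂ g) := by
  intro x _ hx y _ hy
  have hpF : {{x, t₀}, {y, t₁}, {g x y, t₂}} ∈ graphCode M t₀ t₁ t₂ g :=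
    mem_graphCode.2 ⟨x, hx, y, hy, rfl⟩
  have hp := hB _ hF hpF
  have h0 := hB _ hp (show {x, t₀} ∈ _ by simp)
  have h1 := hB _ hp (show {y, t₁} ∈ _ by simp)
  have h2 := hB _ hp (show {g x y, t₂} ∈ _ by simp)
  exact ⟨g x y, hB _ h2 (by simp), hg x hx y hy, _, hp, hpF, ⟨_, h0, by simp, by simp, by simp⟩,
    ⟨_, h1, by simp, by simp, by simp⟩, ⟨_, h2, by simp, by simp, by simp⟩⟩

/-- The tags are distinct and outside `M`, so a tag determines which of the three pairs contains it,
and the coordinate is the other element. This needs no transitivity of `B`. -/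
theorem IsClosedUnder.apply_mem (hg : ∀ x ∈ M, ∀ y ∈ M, g x y ∈ M) (ht₀ : t₀ ∉ M)
    (ht₁ : t₁ ∉ M) (ht₂ : t₂ ∉ M) (h01 : t₀ ≠ t₁) (h02 : t₀ ≠ t₂) (h12 : t₁ ≠ t₂)
    {B : ZFSet.{u}} (hB : IsClosedUnder B M t₀ t₁ t₂ (graphCode M t₀ t₁ t₂ g)) {x y : ZFSet.{u}}
    (hxB : x ∈ B) (hxM : x ∈ M) (hyB : y ∈ B) (hyM : y ∈ M) : g x y ∈ B := by
  obtain ⟨z, hzB, hzM, p, -, hpF, ⟨s, -, hsp, hts, hxs⟩, ⟨r, -, hrp, htr, hyr⟩,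
    q, -, hqp, htq, hzq⟩ := hB x hxB hxM y hyB hyM
  obtain ⟨x', hx', y', hy', rfl⟩ := mem_graphCode.1 hpF
  have hne : ∀ w ∈ M, ∀ t, t ∉ M → t ≠ w := fun w hw t ht h => ht (h ▸ hw)
  have hne' : ∀ w ∈ M, ∀ t, t ∉ M → w ≠ t := fun w hw t ht h => ht (h ▸ hw)
  have hs : x = x' := by
    simp only [ZFSet.mem_insert_iff, ZFSet.mem_singleton] at hsp
    rcases hsp with rfl | rfl | rfl
    · simpa [hne' x hxM t₀ ht₀] using hxs
    · simp [h01, hne _ hy' t₀ ht₀] at hts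
    · simp [h02, hne _ (hg _ hx' _ hy') t₀ ht₀] at hts
  have hr : y = y' := by
    simp only [ZFSet.mem_insert_iff, ZFSet.mem_singleton] at hrp
    rcases hrp with rfl | rfl | rfl
    · simp [h01.symm, hne _ hx' t₁ ht₁] at htr
    · simpa [hne' y hyM t₁ ht₁] using hyr
    · simp [h12, hne _ (hg _ hx' _ hy') t₁ ht₁] at htr
  have hq : z = g x' y' := by
    simp only [ZFSet.mem_insert_iff, ZFSet.mem_singleton] at hqp
    rcases hqp with rfl | rfl | rfl
    · simp [h02.symm, hne _ hx' t₂ ht₂] at htq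
    · simp [h12.symm, hne _ hy' t₂ ht₂] at htq
    · simpa [hne' z hzM t₂ ht₂] using hzq
  rwa [hs, hr, ← hq]

end GraphCode

/-- The formula expressing, for the parameters `K, M, t₀, t₁, t₂, F₀, F₁, F₂, R` in this order,
that the second sort is extensional, that its elements in `K` are exactly the elements of the
first sort, that it is closed under the functions coded by the `Fᵢ`, and that `M` contains all
subsets of `R`. -/
def closedSubstructure : Formula 0 9 :=
  .conj (.allSnd (.allSnd (.imp
      (.allSnd (.conj
        (.imp (.mem (.inr (Fin.last 11)) (.inr (Fin.last 9).castSucc.castSucc))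
          (.mem (.inr (Fin.last 11)) (.inr (Fin.last 10).castSucc)))
        (.imp (.mem (.inr (Fin.last 11)) (.inr (Fin.last 10).castSucc))
          (.mem (.inr (Fin.last 11)) (.inr (Fin.last 9).castSucc.castSucc)))))
      (.eq (.inr (Fin.last 9).castSucc) (.inr (Fin.last 10)))))) <|
  .conj (.allFst (.exSnd (.eq (.inl (Fin.last 0)) (.inr (Fin.last 9))))) <|
  .conj (.allSnd (.imp (.mem (.inr (Fin.last 9)) (.inr (0 : Fin 9).castSucc))
    (.exFst (.eq (.inl (Fin.last 0)) (.inr (Fin.last 9)))))) <|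
  .conj (closedUnder 1 2 3 4 5) <|
  .conj (closedUnder 1 2 3 4 6) <|
  .conj (closedUnder 1 2 3 4 7) <|
  .allSnd (.imp
    (.allSnd (.imp (.mem (.inr (Fin.last 10)) (.inr (Fin.last 9).castSucc))
      (.mem (.inr (Fin.last 10)) (.inr (8 : Fin 9).castSucc.castSucc))))
    (.mem (.inr (Fin.last 9)) (.inr (1 : Fin 9).castSucc)))

theorem sat_closedSubstructure {A B K M t₀ t₁ t₂ F₀ F₁ F₂ R : ZFSet.{u}} {a : Fin 0 → ZFSet.{u}} :
    closedSubstructure.Sat A B a ![K, M, t₀, t₁, t₂, F₀, F₁, F₂, R] ↔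
      (∀ x ∈ B, ∀ y ∈ B, (∀ z ∈ B, (z ∈ x ↔ z ∈ y)) → x = y) ∧ (∀ x ∈ A, x ∈ B) ∧
      (∀ x ∈ B, x ∈ K → x ∈ A) ∧
      IsClosedUnder B M t₀ t₁ t₂ F₀ ∧ IsClosedUnder B M t₀ t₁ t₂ F₁ ∧
      IsClosedUnder B M t₀ t₁ t₂ F₂ ∧ ∀ z ∈ B, (∀ w ∈ B, w ∈ z → w ∈ R) → z ∈ M := by
  simp only [closedSubstructure, sat_conj, sat_allSnd, sat_allFst, sat_exSnd, sat_exFst, sat_imp,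
    sat_mem, sat_eq, sat_closedUnder, Sum.elim_inl, Sum.elim_inr, Fin.snoc_castSucc,
    Fin.snoc_last, exists_eq_right, exists_eq_right', iff_def]
  exact ⟨id, id⟩

/-- A combinatorial form of reflection: there are small sets closed under a given binary
function such that each of their subsets is the trace of a set `Z'` for which they
contain a given small set `Ψ Z'`. -/
theorem LevelReflects.exists_closed_set {κ : Ordinal.{u}} (h : LevelReflects κ) {T : Type u}
    [Nonempty T] (f : T → T → T) (Ψ : Set T → Set T) (hΨ : ∀ Z, #(Ψ Z) < κ.card) :
    ∃ Y : Set T, #Y < κ.card ∧ (∀ x ∈ Y, ∀ y ∈ Y, f x y ∈ Y) ∧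
      ∀ Z ⊆ Y, ∃ Z', Z' ∩ Y = Z ∧ Ψ Z' ⊆ Y := by
  obtain ⟨code, hcode⟩ : ∃ code : T → ZFSet.{u}, Function.Injective code :=
    ⟨fun t => (Ordinal.typein WellOrderingRel t).toZFSet,
      Ordinal.toZFSet_injective.comp (Ordinal.typein_injective _)⟩
  let R : ZFSet.{u} := ZFSet.range code
  let μ : Ordinal.{u} := max κ (R.rank + 1)
  have hcodeR : ∀ t, code t ∈ R := fun t => ZFSet.mem_range.2 ⟨t, rfl⟩
  have hRM : R ∈ V_ μ := ZFSet.mem_vonNeumann.2 (lt_max_of_lt_right (by simp))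
  have hcodeM : ∀ t, code t ∈ V_ μ := fun t =>
    ZFSet.isTransitive_vonNeumann _ _ hRM (hcodeR t)
  have hKM : V_ κ ⊆ V_ μ := ZFSet.vonNeumann_subset_of_le (le_max_left _ _)
  let decode : ZFSet.{u} → T := Function.invFun code
  have hdecode : ∀ t, decode (code t) = t := Function.leftInverse_invFun hcode
  let hat : ZFSet.{u} → Set T := fun z => {t | code t ∈ z}
  let d : Set T → Ordinal.{u} := fun Z => (#(Ψ Z)).ord
  have hd : ∀ Z, (d Z).toZFSet ∈ V_ κ := fun Z => by
    rw [ZFSet.mem_vonNeumann, Ordinal.rank_toZFSet, ← h.ord_card]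
    exact ord_lt_ord.2 (hΨ Z)
  have henum : ∀ Z, ∃ e : ZFSet.{u} → T, ∀ t ∈ Ψ Z, ∃ η ∈ (d Z).toZFSet, e η = t := by
    intro Z
    have hcard : #(Ψ Z) = #(Shrink (d Z).toZFSet) := by
      change _ = (d Z).toZFSet.card
      simp [d]
    obtain ⟨e⟩ := Cardinal.eq.1 hcard
    let E : Ψ Z → ZFSet.{u} := fun t => ((equivShrink (d Z).toZFSet).symm (e t)).1
    have hE : Function.Injective E :=
      Subtype.val_injective.comp ((Equiv.injective _).comp e.injective)
    rcases isEmpty_or_nonempty (Ψ Z) with hem | hne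
    · exact ⟨fun _ => Classical.arbitrary T, fun t ht => (hem.false ⟨t, ht⟩).elim⟩
    · exact ⟨fun η => (Function.invFun E η).1, fun t ht => ⟨E ⟨t, ht⟩,
        ((equivShrink (d Z).toZFSet).symm (e ⟨t, ht⟩)).2,
        congrArg Subtype.val (Function.leftInverse_invFun hE ⟨t, ht⟩)⟩⟩
  choose e he using henum
  let g₀ : ZFSet.{u} → ZFSet.{u} → ZFSet.{u} := fun x y => code (f (decode x) (decode y))
  -- `g₁` gives the length of an enumeration of `Ψ (hat z)` and `g₂` its entries; each ignores or
  -- reads the second argument as an index.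
  let g₁ : ZFSet.{u} → ZFSet.{u} → ZFSet.{u} := fun z _ => (d (hat z)).toZFSet
  let g₂ : ZFSet.{u} → ZFSet.{u} → ZFSet.{u} := fun z η => code (e (hat z) η)
  have hg₀ : ∀ x ∈ V_ μ, ∀ y ∈ V_ μ, g₀ x y ∈ V_ μ := fun _ _ _ _ => hcodeM _
  have hg₁ : ∀ x ∈ V_ μ, ∀ y ∈ V_ μ, g₁ x y ∈ V_ μ := fun _ _ _ _ => hKM (hd _)
  have hg₂ : ∀ x ∈ V_ μ, ∀ y ∈ V_ μ, g₂ x y ∈ V_ μ := fun _ _ _ _ => hcodeM _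
  have ht₀ : V_ μ ∉ V_ μ := ZFSet.mem_irrefl _
  have ht₁ : V_ (μ + 1) ∉ V_ μ := by simp [-ZFSet.vonNeumann_add_one]
  have ht₂ : V_ (μ + 2) ∉ V_ μ := by simp
  have h01 : V_ μ ≠ V_ (μ + 1) := by simp [-ZFSet.vonNeumann_add_one]
  have h02 : V_ μ ≠ V_ (μ + 2) := by simp
  have h12 : V_ (μ + 1) ≠ V_ (μ + 2) := by simp [-ZFSet.vonNeumann_add_one]
  let b : Fin 9 → ZFSet.{u} := ![V_ κ, V_ μ, V_ μ, V_ (μ + 1), V_ (μ + 2),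
    graphCode (V_ μ) (V_ μ) (V_ (μ + 1)) (V_ (μ + 2)) g₀,
    graphCode (V_ μ) (V_ μ) (V_ (μ + 1)) (V_ (μ + 2)) g₁,
    graphCode (V_ μ) (V_ μ) (V_ (μ + 1)) (V_ (μ + 2)) g₂, R]
  obtain ⟨l, hl, hb⟩ : ∃ l, κ < l ∧ ∀ i, b i ∈ V_ l :=
    ⟨max (κ + 1) (ZFSet.range b).rank, lt_max_of_lt_left (by simp), fun i =>
      ZFSet.mem_vonNeumann.2 (lt_max_of_lt_right
        (ZFSet.rank_lt_of_mem (ZFSet.mem_range.2 ⟨i, rfl⟩)))⟩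
  have htr := ZFSet.isTransitive_vonNeumann l
  obtain ⟨α, hα, X, -, -, hbX, hX, ⟨β, -, hβ⟩, hsat⟩ := h l hl 0 9 closedSubstructure Fin.elim0 b
    (fun i => i.elim0) hb (by
      refine sat_closedSubstructure.2 ⟨fun x hx y hy hxy => ?_,
        fun x hx => ZFSet.vonNeumann_subset_of_le hl.le hx, fun x _ hx => hx,
        isClosedUnder_graphCode hg₀ htr (hb 5), isClosedUnder_graphCode hg₁ htr (hb 6),
        isClosedUnder_graphCode hg₂ htr (hb 7), fun z hz hzR => ?_⟩
      · ext z
        exact ⟨fun hz => (hxy z (htr _ hx hz)).1 hz, fun hz => (hxy z (htr _ hy hz)).2 hz⟩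
      · exact ZFSet.mem_vonNeumann_of_subset (fun w hw => hzR w (htr _ hz hw) hw) hRM)
  obtain ⟨hext, hAX, hXA, hc₀, hc₁, hc₂, hsubR⟩ := sat_closedSubstructure.1 hsat
  have hRX : R ∈ X := hbX 8
  refine ⟨{t | code t ∈ X}, ?_, ?_, fun Z hZ => ?_⟩
  · refine lt_of_le_of_lt ?_ (hX.trans_le h.beth_le_card)
    refine mk_le_of_injective (f := fun t => equivShrink X ⟨code t.1, t.2⟩) fun t t' htt' => ?_
    simpa [hcode.eq_iff, Subtype.ext_iff] using htt'
  · intro x hx y hy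
    have := hc₀.apply_mem hg₀ ht₀ ht₁ ht₂ h01 h02 h12 hx (hcodeM x) hy (hcodeM y)
    simpa [g₀, hdecode] using this
  · obtain ⟨z, hzX, hz⟩ := exists_inter_eq_of_transitiveCollapse hext hβ hRX (code '' Z) (by
      rintro _ ⟨t, ht, rfl⟩
      exact ⟨hcodeR t, hZ ht⟩)
    refine ⟨hat z, ?_, fun t ht => ?_⟩
    · ext t
      refine ⟨fun ⟨h1, h2⟩ => ?_, fun ht => ⟨(hz _ (hZ ht)).2 ⟨t, ht, rfl⟩, hZ ht⟩⟩
      obtain ⟨t', ht', htt'⟩ := (hz _ h2).1 h1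
      rwa [← hcode htt']
    · have hzM : z ∈ V_ μ := hsubR z hzX fun w hw hwz => by
        obtain ⟨t, -, rfl⟩ := (hz w hw).1 hwz
        exact hcodeR t
      -- The length lies in `X` and in `V_ κ`, hence in `V_ α`, which is transitive and contained in
      -- `X`. So `X` contains all indices and, by closure under `g₂`, all of `Ψ (hat z)`.
      have hdX : (d (hat z)).toZFSet ∈ X :=
        hc₁.apply_mem hg₁ ht₀ ht₁ ht₂ h01 h02 h12 hzX hzM hzX hzM
      obtain ⟨η, hη, rfl⟩ := he _ t ht
      have hηα : η ∈ V_ α := ZFSet.isTransitive_vonNeumann _ _ (hXA _ hdX (hd _)) hη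
      exact hc₂.apply_mem hg₂ ht₀ ht₁ ht₂ h01 h02 h12 hzX hzM (hAX η hηα)
        (hKM (ZFSet.vonNeumann_subset_of_le hα.le hηα))

/-! ### Normal measures from reflection -/

/-- The subsets of `P_κ(A)` belonging to a normal measure, described without filters. -/
structure IsNormalMeasureSets (c : Cardinal.{u}) (A : Type u)
    (W : Set (Set (SmallSubset c A))) : Prop where
  superset_sInter : ∀ C ⊆ W, #C < c → ∀ S, ⋂₀ C ⊆ S → S ∈ W
  compl : ∀ S, Sᶜ ∉ W ↔ S ∈ W
  fine : ∀ x, {s | x ∈ s.1} ∈ W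
  normal : ∀ f : SmallSubset c A → A, {s | f s ∈ s.1} ∈ W → ∃ x, {s | f s = x} ∈ W

theorem IsNormalMeasureSets.exists_isNormalMeasure {c : Cardinal.{u}} {A : Type u}
    {W : Set (Set (SmallSubset c A))} (hc : ℵ₀ < c) (hW : IsNormalMeasureSets c A W) :
    ∃ U : Ultrafilter (SmallSubset c A), IsNormalMeasure c A U := by
  have hc2 : 2 < c := (natCast_lt_aleph0 (n := 2)).trans hc
  let l : Filter (SmallSubset c A) := Filter.ofCardinalInter W hc2
    (fun C hC hCW => hW.superset_sInter C hCW hC _ subset_rfl)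
    (fun S S' hS hSS' => hW.superset_sInter {S} (by simpa using hS)
      (by simpa using one_lt_aleph0.trans hc) S' (by simpa using hSS'))
  refine ⟨Ultrafilter.ofComplNotMemIff l hW.compl, ⟨fun C hC hCW => ?_⟩, hW.fine, hW.normal⟩
  exact hW.superset_sInter C hCW hC _ subset_rfl

/-- If `W` is not the collection of members of a normal measure, then this is witnessed by a small
set of elements of `A`, subsets of `P_κ(A)` and functions from `P_κ(A)` to `A`. -/
theorem exists_witness_of_not_isNormalMeasureSets {c : Cardinal.{u}} {A : Type u} (hc : ℵ₀ < c)
    {W : Set (Set (SmallSubset c A))} (hW : ¬ IsNormalMeasureSets c A W) :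
    ∃ w : Set (A ⊕ Set (SmallSubset c A) ⊕ (SmallSubset c A → A)), #w < c ∧
      ∀ (Y : Set (A ⊕ Set (SmallSubset c A) ⊕ (SmallSubset c A → A))) (s : SmallSubset c A),
        w ⊆ Y → (∀ x, x ∈ s.1 ↔ .inl x ∈ Y) →
        (∀ S, .inr (.inl S) ∈ Y → (S ∈ W ↔ s ∈ S)) →
        (∀ f x, .inr (.inr f) ∈ Y → .inl x ∈ Y → .inr (.inl {s | f s = x}) ∈ Y) → False := by
  have hpair : ∀ x y : A ⊕ Set (SmallSubset c A) ⊕ (SmallSubset c A → A),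
      #({x, y} : Set (A ⊕ Set (SmallSubset c A) ⊕ (SmallSubset c A → A))) < c := fun x y =>
    (lt_aleph0_iff_set_finite.2 (Set.toFinite _)).trans hc
  -- Now every small `w` has a `Y` and an `s` for which `W` agrees on `Y` with the principal
  -- ultrafilter at `s`. Each clause is tested on the few objects it involves; for normality,
  -- closure of `Y` supplies the fibre of `f` over `f s`.
  by_contra! hcon
  refine hW ⟨fun C hCW hC S hCS => ?_, fun S => ?_, fun x => ?_, fun f hf => ?_⟩
  · obtain ⟨Y, s, hwY, -, hs, -⟩ := hcon ((fun S => .inr (.inl S)) '' insert S C) (by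
      refine mk_image_le.trans_lt ((mk_insert_le).trans_lt ?_)
      exact add_lt_of_lt hc.le hC (one_lt_aleph0.trans hc))
    refine (hs S (hwY ⟨S, by simp, rfl⟩)).2 (hCS fun S' hS' => ?_)
    exact (hs S' (hwY ⟨S', by simp [hS'], rfl⟩)).1 (hCW hS')
  · obtain ⟨Y, s, hwY, -, hs, -⟩ := hcon _ (hpair (.inr (.inl S)) (.inr (.inl Sᶜ)))
    rw [hs S (hwY (by simp)), hs Sᶜ (hwY (by simp))]
    simp
  · obtain ⟨Y, s, hwY, hY, hs, -⟩ := hcon _ (hpair (.inl x) (.inr (.inl {s | x ∈ s.1})))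
    exact (hs _ (hwY (by simp))).2 ((hY x).2 (hwY (by simp)))
  · obtain ⟨Y, s, hwY, hY, hs, hcl⟩ := hcon _ (hpair (.inr (.inr f)) (.inr (.inl {s | f s ∈ s.1})))
    have hfs : f s ∈ s.1 := (hs _ (hwY (by simp))).1 hf
    exact ⟨f s, (hs _ (hcl.1 f (f s) (hwY (by simp)) ((hY _).1 hfs))).2 rfl⟩

theorem LevelReflects.isSupercompact_card {κ : Ordinal.{u}} (h : LevelReflects κ) :
    IsSupercompact κ.card := by
  have hc := h.aleph0_lt_card
  refine ⟨hc, fun A _ => ?_⟩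
  by_contra hcon
  let P := SmallSubset κ.card A
  let T := A ⊕ Set P ⊕ (P → A)
  have hW : ∀ W : Set (Set P), ¬ IsNormalMeasureSets κ.card A W := fun W hW =>
    hcon (hW.exists_isNormalMeasure hc)
  choose w hwc hw using fun W => exists_witness_of_not_isNormalMeasureSets hc (hW W)
  have : Nonempty T := ⟨.inr (.inl ∅)⟩
  let fib : T → T → T := fun p q => match p, q with
    | .inr (.inr f), .inl x => .inr (.inl {s | f s = x})
    | p, _ => p
  obtain ⟨Y, hY, hfib, hsub⟩ := h.exists_closed_set fib
    (fun Z => w {S | .inr (.inl S) ∈ Z}) (fun _ => hwc _)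
  let s : P := ⟨Sum.inl ⁻¹' Y, (mk_preimage_of_injective _ _ Sum.inl_injective).trans_lt hY⟩
  -- The family coded by `Z` agrees on `Y` with the principal ultrafilter at `s`, yet its own
  -- witness lies in `Y`.
  obtain ⟨Z, hZ, hwZ⟩ := hsub {t | t ∈ Y ∧ ∃ S : Set P, .inr (.inl S) = t ∧ s ∈ S} fun t ht => ht.1
  refine hw _ Y s hwZ (fun _ => Iff.rfl) (fun S hS => ?_) fun f x hf hx => hfib _ hf _ hx
  have hSZ := Set.ext_iff.1 hZ (.inr (.inl S))
  simp only [Set.mem_inter_iff, hS, and_true] at hSZ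
  refine hSZ.trans ⟨?_, fun h => ⟨hS, S, rfl, h⟩⟩
  rintro ⟨-, S', hS', h⟩
  cases hS'
  exact h

end LevelReflection

theorem mainTheorem1 (κ : Ordinal.{u}) :
    LevelReflection.LevelReflects κ ↔
      ∃ c : Cardinal.{u}, c.ord = κ ∧ LevelReflection.IsSupercompact c := by
  constructor
  · intro h
    exact ⟨κ.card, h.ord_card, h.isSupercompact_card⟩
  · rintro ⟨c, rfl, hc⟩
    exact hc.levelReflects
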